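/- Theorem (Consistent Invariant Variable Selection for Transfer Lasso). Fix $p\in\mathbb{N}$, $\beta^*\in\mathbb{R}^p$ and $\sigma\ge 0$, and let $S=\{j:\beta^*_j\neq 0\}$. For each $n$ let $y=X\beta^*+\varepsilon\in\mathbb{R}^n$, where $X=X_n\in\mathbb{R}^{n\times p}$ is a deterministic design matrix with rows $x_1,\dots,x_n$ and $\varepsilon=\varepsilon^{(n)}$ has i.i.d. $\mathcal{N}(0,\sigma^2)$ components. Assume that, as $n\to\infty$, $$\frac1n X^\top X\to C \text{ with } C \text{ positive definite},\qquad \frac1n\max_{i}\|x_i\|_2^2\to 0 .$$ Let $m=m_n$ be integers, positive for all large $n$, with $n/m\to r_0$ for some $r_0\in[0,\infty)$. Let $\tilde\beta=\tilde\beta_n$ be a random vector in $\mathbb{R}^p$ (the initial estimator), independent of $\varepsilon^{(n)}$, such that $\sqrt m(\tilde\beta-\beta^*)$ converges in distribution to some probability law on $\mathbb{R}^p$ (in particular $\tilde\beta$ is $\sqrt m$-consistent). Suppose that $\tilde\beta$ is inconsistent with respect to active variable selection: there is a constant $c<1$ with $$\limsup_{n\to\infty}P\big(\{j:\tilde\beta_j\ne0\}=S\big)\le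 c .$$ Let $\hat\beta_n^{\mathcal T}$ be the Transfer Lasso estimator, i.e. any minimizer over $\beta\in\mathbb{R}^p$ of $$\frac1n\|y-X\beta\|_2^2+\frac{\lambda_n}{n}\sum_{j}|\beta_j|+\frac{\eta_n}{n}\sum_j|\beta_j-\tilde\beta_j| .$$ If $\eta_n/\sqrt n\to\infty$ and $\lambda_n/\eta_n\to\rho_0$ with $0\le\rho_0<1$, then the Transfer Lasso yields consistent invariant variable selection, that is, $$P\big(\hat\beta^{\mathcal T}_{n,j}=\tilde\beta_j\ \text{ for all } j\in S\big)\to 1\qquad(n\to\infty).$$ -/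

import Mathlib

open MeasureTheory ProbabilityTheory Filter Topology
open scoped Matrix NNReal ENNReal

/-- The active set `S = {j : β j ≠ 0}` of a coefficient vector. -/
def activeSet {p : ℕ} (β : Fin p → ℝ) : Set (Fin p) := {j | β j ≠ 0}

/-- The response `y = X β* + ε` of the linear model. -/
noncomputable def linearResponse {n p : ℕ} (X : Matrix (Fin n) (Fin p) ℝ) (βstar : Fin p → ℝ)
    (ε : Fin n → ℝ) : Fin n → ℝ :=
  X *ᵥ βstar + ε

/-- The Gram matrix `C_n = (1/n) Xᵀ X`. -/
noncomputable def gramMatrix {n p : ℕ} (X : Matrix (Fin n) (Fin p) ℝ) :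
    Matrix (Fin p) (Fin p) ℝ :=
  (1 / (n : ℝ)) • (Xᵀ * X)

/-- The normalized largest squared row norm `(1/n) max_i ‖x_i‖₂²`
(a maximum over finitely many rows). -/
noncomputable def maxRowSqNorm {n p : ℕ} (X : Matrix (Fin n) (Fin p) ℝ) : ℝ :=
  (1 / (n : ℝ)) * ⨆ i : Fin n, ∑ j : Fin p, X i j ^ 2

/-- The Transfer Lasso objective
`(1/n) ‖y - X β‖₂² + (lam/n) ∑ |β_j| + (eta/n) ∑ |β_j - βinit_j|`. -/
noncomputable def transferLassoObjective {n p : ℕ} (X : Matrix (Fin n) (Fin p) ℝ)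
    (y : Fin n → ℝ) (βinit : Fin p → ℝ) (lam eta : ℝ) (β : Fin p → ℝ) : ℝ :=
  (1 / (n : ℝ)) * ∑ i : Fin n, (y i - (X *ᵥ β) i) ^ 2
    + (lam / n) * ∑ j : Fin p, |β j|
    + (eta / n) * ∑ j : Fin p, |β j - βinit j|

/-- `βhat` is a Transfer Lasso solution: a global minimizer of the objective. -/
def IsTransferLasso {n p : ℕ} (X : Matrix (Fin n) (Fin p) ℝ) (y : Fin n → ℝ)
    (βinit : Fin p → ℝ) (lam eta : ℝ) (βhat : Fin p → ℝ) : Prop :=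
  IsMinOn (transferLassoObjective X y βinit lam eta) Set.univ βhat

/-- Inconsistent active variable selection of a sequence of estimators `b`:
`limsup P(Ŝ_n = S) ≤ c < 1` for a constant `c`. -/
def InconsistentActiveSelection {Ω : Type*} [MeasurableSpace Ω] (P : Measure Ω) {p : ℕ}
    (βstar : Fin p → ℝ) (b : ℕ → Ω → Fin p → ℝ) : Prop :=
  ∃ c : ℝ≥0∞, c < 1 ∧
    limsup (fun n => P {ω | activeSet (b n ω) = activeSet βstar}) atTop ≤ c

/-- Consistent invariant variable selection: `P(βhat_S = βinit_S) → 1`. -/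
def ConsistentInvariantSelection {Ω : Type*} [MeasurableSpace Ω] (P : Measure Ω) {p : ℕ}
    (βstar : Fin p → ℝ) (βinit βhat : ℕ → Ω → Fin p → ℝ) : Prop :=
  Tendsto (fun n => P {ω | ∀ j ∈ activeSet βstar, βhat n ω j = βinit n ω j}) atTop (𝓝 1)

/-! The transfer penalty has a kink at the initial estimator `b`. Moving from `b` to `b + u` costs
`eta * |u j|` in each coordinate, while the lasso penalty can fall by at most `|lam| * |u j|` and
the unnormalized squared loss by at most `2 * |score j| * |u j|` in total over `j`. Once `2 * |score
j| < eta - |lam|` for every `j`, no move pays, so the minimizer is `b` in all coordinates, not only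
the active ones. The score is `Xᵀ ε - n C_n (b - β*)`. Both terms are of order `√n` in probability:
the first by Chebyshev, the second because `n / √m = √n * √(n/m)` with `n/m` convergent. The gap is
about `(1 - ρ₀) * eta`, which dominates `√n`, and a union bound over the `p` coordinates finishes.
-/

/-- If every coordinate of the score `Xᵀ (y - X b)` at the initial estimator `b` is dominated by
the penalty gap `eta - |lam|`, then `b` is the only Transfer Lasso solution. -/
theorem IsTransferLasso.eq_init_of_score_lt {n p : ℕ} {X : Matrix (Fin n) (Fin p) ℝ}
    {y : Fin n → ℝ} {b βhat : Fin p → ℝ} {lam eta : ℝ} (hn : 0 < n)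
    (h : IsTransferLasso X y b lam eta βhat)
    (hscore : ∀ j, 2 * |(Xᵀ *ᵥ (y - X *ᵥ b)) j| < eta - |lam|) : βhat = b := by
  have hn' : (0 : ℝ) < n := Nat.cast_pos.mpr hn
  have hmin := h (Set.mem_univ b)
  simp only [Set.mem_ofPred_eq, transferLassoObjective, sub_self, abs_zero,
    Finset.sum_const_zero, mul_zero, add_zero] at hmin
  set u : Fin p → ℝ := βhat - b with hu
  set r : Fin n → ℝ := y - X *ᵥ b with hr
  have hmin' : ∑ i, (y i - (X *ᵥ βhat) i) ^ 2 + lam * ∑ j, |βhat j| + eta * ∑ j, |u j|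
      ≤ ∑ i, (y i - (X *ᵥ b) i) ^ 2 + lam * ∑ j, |b j| := by
    have := mul_le_mul_of_nonneg_left hmin hn'.le
    have e1 : ∀ a c d : ℝ, (n : ℝ) * (1 / n * a + lam / n * c + eta / n * d)
        = a + lam * c + eta * d := by intro a c d; field_simp
    have e2 : ∀ a c : ℝ, (n : ℝ) * (1 / n * a + lam / n * c) = a + lam * c := by
      intro a c; field_simp
    rw [e1, e2] at this
    exact this
  have hres : ∀ i, y i - (X *ᵥ βhat) i = r i - (X *ᵥ u) i := by
    intro i
    simp [hr, hu, Matrix.mulVec_sub]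
  have hcross : ∑ i, r i * (X *ᵥ u) i = ∑ j, (Xᵀ *ᵥ r) j * u j := by
    change r ⬝ᵥ (X *ᵥ u) = (Xᵀ *ᵥ r) ⬝ᵥ u
    rw [Matrix.dotProduct_mulVec, Matrix.mulVec_transpose]
  have hsq : ∑ i, (y i - (X *ᵥ βhat) i) ^ 2
      = ∑ i, r i ^ 2 - 2 * ∑ j, (Xᵀ *ᵥ r) j * u j + ∑ i, (X *ᵥ u) i ^ 2 := by
    rw [← hcross, Finset.mul_sum, ← Finset.sum_sub_distrib, ← Finset.sum_add_distrib]
    refine Finset.sum_congr rfl fun i _ => ?_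
    rw [hres]; ring
  have hsq0 : 0 ≤ ∑ i, (X *ᵥ u) i ^ 2 := Finset.sum_nonneg fun i _ => sq_nonneg _
  -- The sign of `lam` is not assumed, hence `|lam|` in the reverse triangle inequality.
  have hlam : ∑ j, lam * (|b j| - |βhat j|) ≤ ∑ j, |lam| * |u j| := by
    refine Finset.sum_le_sum fun j _ => (le_abs_self _).trans ?_
    rw [abs_mul]
    refine mul_le_mul_of_nonneg_left ?_ (abs_nonneg _)
    rw [hu, Pi.sub_apply, abs_sub_comm (βhat j)]
    exact abs_abs_sub_abs_le_abs_sub _ _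
  have hdef : ∑ i, (y i - (X *ᵥ b) i) ^ 2 = ∑ i, r i ^ 2 := rfl
  -- Dropping `‖X u‖² ≥ 0` leaves a sum of nonnegative terms that is at most zero; strict positivity
  -- of the weights then forces `u = 0`.
  have hsum : ∑ j, (eta - |lam| - 2 * |(Xᵀ *ᵥ r) j|) * |u j| ≤ 0 := by
    have h1 : ∑ j, (eta - |lam| - 2 * |(Xᵀ *ᵥ r) j|) * |u j|
        ≤ ∑ j, (eta * |u j| - |lam| * |u j| - 2 * ((Xᵀ *ᵥ r) j * u j)) := by
      refine Finset.sum_le_sum fun j _ => ?_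
      have := le_abs_self ((Xᵀ *ᵥ r) j * u j)
      rw [abs_mul] at this
      linarith
    rw [Finset.sum_sub_distrib, Finset.sum_sub_distrib, ← Finset.mul_sum, ← Finset.mul_sum,
      ← Finset.mul_sum] at h1
    rw [← Finset.mul_sum, Finset.sum_sub_distrib, ← Finset.mul_sum] at hlam
    linarith
  have hnonneg : ∀ j ∈ Finset.univ, 0 ≤ (eta - |lam| - 2 * |(Xᵀ *ᵥ r) j|) * |u j| :=
    fun j _ => mul_nonneg (by linarith [hscore j]) (abs_nonneg _)
  have hzero := (Finset.sum_eq_zero_iff_of_nonneg hnonneg).mp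
    (le_antisymm hsum (Finset.sum_nonneg hnonneg))
  funext j
  rcases mul_eq_zero.mp (hzero j (Finset.mem_univ j)) with h0 | h0
  · linarith [hscore j]
  · exact sub_eq_zero.mp (abs_eq_zero.mp h0)

/-- In the linear model, the score at `b` is the noise term minus the Gram matrix applied to the
estimation error of `b`. -/
theorem score_linearResponse {n p : ℕ} (hn : 0 < n) (X : Matrix (Fin n) (Fin p) ℝ)
    (βstar b : Fin p → ℝ) (ε : Fin n → ℝ) :
    Xᵀ *ᵥ (linearResponse X βstar ε - X *ᵥ b)
      = Xᵀ *ᵥ ε - (n : ℝ) • (gramMatrix X *ᵥ (b - βstar)) := by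
  have hn' : (n : ℝ) ≠ 0 := by positivity
  rw [linearResponse, gramMatrix, Matrix.smul_mulVec, smul_smul, mul_one_div_cancel hn', one_smul,
    ← Matrix.mulVec_mulVec, ← Matrix.mulVec_sub, Matrix.mulVec_sub X b βstar]
  congr 1
  abel

/-- A sequence converging in distribution is bounded in probability: it exceeds any diverging
threshold with vanishing probability. -/
theorem MeasureTheory.TendstoInDistribution.tendsto_measure_le_norm {Ω Ω' E : Type*}
    [MeasurableSpace Ω] [MeasurableSpace Ω'] {P : Measure Ω} [IsProbabilityMeasure P]
    {P' : Measure Ω'} [IsProbabilityMeasure P'] [NormedAddCommGroup E] [ProperSpace E]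
    [MeasurableSpace E] [BorelSpace E] {Y : ℕ → Ω → E} {Z : Ω' → E}
    (h : TendstoInDistribution Y atTop Z (fun _ => P) P') {T : ℕ → ℝ}
    (hT : Tendsto T atTop atTop) :
    Tendsto (fun n => P {ω | T n ≤ ‖Y n ω‖}) atTop (𝓝 0) := by
  rw [ENNReal.tendsto_nhds_zero]
  intro δ hδ
  have : IsProbabilityMeasure (P'.map Z) := Measure.isProbabilityMeasure_map h.aemeasurable_limit
  have htight := isTightMeasureSet_iff_tendsto_measure_norm_gt.mp
    (isTightMeasureSet_singleton (μ := P'.map Z))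
  simp only [Set.mem_singleton_iff, iSup_iSup_eq_left] at htight
  obtain ⟨M, hM⟩ := (htight.eventually_lt_const hδ).exists
  -- The portmanteau bound needs a closed set; raising the threshold to `M + 1` puts the closed tail
  -- inside the strict tail beyond `M`.
  have hclosed : IsClosed {x : E | M + 1 ≤ ‖x‖} := isClosed_le continuous_const continuous_norm
  have hlim : limsup (fun n => P.map (Y n) {x : E | M + 1 ≤ ‖x‖}) atTop < δ := by
    refine (ProbabilityMeasure.limsup_measure_closed_le_of_tendsto h.tendsto hclosed).trans_lt ?_
    refine (measure_mono fun x hx => ?_).trans_lt hM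
    simp only [Set.mem_ofPred_eq] at hx ⊢
    linarith
  filter_upwards [eventually_lt_of_limsup_lt hlim, hT.eventually_ge_atTop (M + 1)] with n h1 h2
  rw [Measure.map_apply_of_aemeasurable (h.forall_aemeasurable n) hclosed.measurableSet] at h1
  exact (measure_mono fun ω hω => h2.trans hω).trans h1.le

/-- Chebyshev bound for a linear combination of i.i.d. centred Gaussian variables. -/
theorem measure_le_abs_sum_mul_gaussian_le {Ω ι : Type*} [MeasurableSpace Ω] [Fintype ι]
    {P : Measure Ω} [IsProbabilityMeasure P] {v : ℝ≥0} {ξ : ι → Ω → ℝ}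
    (hlaw : ∀ i, HasLaw (ξ i) (gaussianReal 0 v) P) (hindep : iIndepFun ξ P) (a : ι → ℝ)
    {t : ℝ} (ht : 0 < t) :
    P {ω | t ≤ |∑ i, a i * ξ i ω|} ≤ ENNReal.ofReal (v * (∑ i, a i ^ 2) / t ^ 2) := by
  have hmem : ∀ i, MemLp (ξ i) 2 P := fun i => by
    have h2 : MemLp id 2 (P.map (ξ i)) := by
      rw [(hlaw i).map_eq]; exact memLp_id_gaussianReal 2
    exact h2.comp_of_map (hlaw i).aemeasurable
  have hmem' : ∀ i, MemLp (fun ω => a i * ξ i ω) 2 P := fun i => (hmem i).const_mul (a i)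
  have hmean : P[fun ω => ∑ i, a i * ξ i ω] = 0 := by
    rw [integral_finsetSum _ fun i _ => (hmem' i).integrable one_le_two]
    refine Finset.sum_eq_zero fun i _ => ?_
    rw [integral_const_mul, (hlaw i).integral_eq, integral_id_gaussianReal, mul_zero]
  have hvar : Var[fun ω => ∑ i, a i * ξ i ω; P] = v * ∑ i, a i ^ 2 := by
    have hfun : (fun ω => ∑ i, a i * ξ i ω) = ∑ i, fun ω => a i * ξ i ω := by
      ext ω; simp
    rw [hfun, IndepFun.variance_sum (fun i _ => hmem' i), Finset.mul_sum]
    · refine Finset.sum_congr rfl fun i _ => ?_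
      rw [variance_const_mul, (hlaw i).variance_eq, variance_id_gaussianReal, mul_comm]
    · intro i _ k _ hik
      exact (hindep.indepFun hik).comp (measurable_const_mul (a i)) (measurable_const_mul (a k))
  have hmemsum : MemLp (fun ω => ∑ i, a i * ξ i ω) 2 P :=
    memLp_finsetSum _ fun i _ => hmem' i
  have := meas_ge_le_variance_div_sq hmemsum ht
  simpa only [hmean, sub_zero, hvar] using this

/-- The normalized noise scores `(Xᵀ ε)_j / √n` are bounded in probability. -/
theorem tendsto_measure_le_abs_noise_score {Ω : Type*} [MeasurableSpace Ω] {P : Measure Ω}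
    [IsProbabilityMeasure P] {p : ℕ} {v : ℝ≥0} {X : ∀ n : ℕ, Matrix (Fin n) (Fin p) ℝ}
    {C : Matrix (Fin p) (Fin p) ℝ} (hgram : Tendsto (fun n => gramMatrix (X n)) atTop (𝓝 C))
    {ε : ∀ n : ℕ, Ω → Fin n → ℝ}
    (hlaw : ∀ (n : ℕ) (i : Fin n), HasLaw (fun ω => ε n ω i) (gaussianReal 0 v) P)
    (hindep : ∀ n : ℕ, iIndepFun (fun (i : Fin n) ω => ε n ω i) P)
    {T : ℕ → ℝ} (hT : Tendsto T atTop atTop) (j : Fin p) :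
    Tendsto (fun n : ℕ => P {ω | √(n : ℝ) * T n ≤ |((X n)ᵀ *ᵥ ε n ω) j|}) atTop (𝓝 0) := by
  have hdiag : Tendsto (fun n => gramMatrix (X n) j j) atTop (𝓝 (C j j)) :=
    (tendsto_pi_nhds.mp ((tendsto_pi_nhds.mp hgram) j)) j
  have hbound : Tendsto (fun n => ENNReal.ofReal (v * gramMatrix (X n) j j / T n ^ 2)) atTop
      (𝓝 0) := by
    have h2 : Tendsto (fun n => T n ^ 2) atTop atTop :=
      (tendsto_pow_atTop two_ne_zero).comp hT
    simpa using ENNReal.tendsto_ofReal ((hdiag.const_mul (v : ℝ)).div_atTop h2)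
  refine tendsto_of_tendsto_of_tendsto_of_le_of_le' tendsto_const_nhds hbound
    (Eventually.of_forall fun _ => zero_le) ?_
  filter_upwards [hT.eventually_gt_atTop 0, eventually_gt_atTop 0] with n hTn hn
  have hn' : (0 : ℝ) < n := Nat.cast_pos.mpr hn
  have h := measure_le_abs_sum_mul_gaussian_le (hlaw n) (hindep n) (fun i => X n i j)
    (mul_pos (Real.sqrt_pos.mpr hn') hTn)
  have hg : gramMatrix (X n) j j = (∑ i, X n i j ^ 2) / n := by
    simp only [gramMatrix, Matrix.smul_apply, Matrix.mul_apply, Matrix.transpose_apply,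
      smul_eq_mul, ← pow_two]
    ring
  rw [mul_pow, Real.sq_sqrt hn'.le] at h
  rw [hg, show (v : ℝ) * ((∑ i, X n i j ^ 2) / n) / T n ^ 2
    = v * (∑ i, X n i j ^ 2) / (n * T n ^ 2) by field_simp]
  exact h

/-- The normalized scores `√n (C_n e)_j` of an estimation error `e` that is `√m`-bounded in
probability are bounded in probability. -/
theorem tendsto_measure_le_abs_gram_mulVec {Ω : Type*} [MeasurableSpace Ω] {P : Measure Ω}
    [IsProbabilityMeasure P] {p : ℕ} {G : ℕ → Matrix (Fin p) (Fin p) ℝ}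
    {C : Matrix (Fin p) (Fin p) ℝ} (hG : Tendsto G atTop (𝓝 C))
    {m : ℕ → ℕ} (hm : ∀ᶠ n in atTop, 0 < m n) {r₀ : ℝ}
    (hnm : Tendsto (fun n : ℕ => (n : ℝ) / (m n : ℝ)) atTop (𝓝 r₀))
    {e : ℕ → Ω → Fin p → ℝ} {ν : Measure (Fin p → ℝ)} [IsProbabilityMeasure ν]
    (he : TendstoInDistribution (fun (n : ℕ) ω => √(m n : ℝ) • e n ω) atTop
      (id : (Fin p → ℝ) → Fin p → ℝ) (fun _ => P) ν)
    {T : ℕ → ℝ} (hT : Tendsto T atTop atTop) (j : Fin p) :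
    Tendsto (fun n : ℕ => P {ω | √(n : ℝ) * T n ≤ |((n : ℝ) • (G n *ᵥ e n ω)) j|})
      atTop (𝓝 0) := by
  have hK : Tendsto (fun n : ℕ => √((n : ℝ) / m n) * ∑ k, |G n j k|) atTop
      (𝓝 (√r₀ * ∑ k, |C j k|)) :=
    hnm.sqrt.mul (tendsto_finsetSum _ fun k _ =>
      (tendsto_pi_nhds.mp ((tendsto_pi_nhds.mp hG) j) k).abs)
  -- The added `1` makes `K` a strict upper bound for the limit, hence an eventual one, and keeps it
  -- positive when `r₀ = 0`.
  set K : ℝ := √r₀ * ∑ k, |C j k| + 1 with hKdef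
  have hKpos : 0 < K := by positivity
  refine tendsto_of_tendsto_of_tendsto_of_le_of_le' tendsto_const_nhds
    (he.tendsto_measure_le_norm (hT.atTop_div_const hKpos))
    (Eventually.of_forall fun _ => zero_le) ?_
  filter_upwards [hK.eventually_lt_const (lt_add_one _), hm, eventually_gt_atTop 0]
    with n hKn hmn hn
  refine measure_mono fun ω hω => ?_
  simp only [Set.mem_ofPred_eq] at hω ⊢
  have hn' : (0 : ℝ) < √(n : ℝ) := Real.sqrt_pos.mpr (Nat.cast_pos.mpr hn)
  have hm' : (0 : ℝ) < √(m n : ℝ) := Real.sqrt_pos.mpr (Nat.cast_pos.mpr hmn)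
  have hmul : |(G n *ᵥ e n ω) j| ≤ (∑ k, |G n j k|) * ‖e n ω‖ := by
    rw [Finset.sum_mul, Matrix.mulVec, dotProduct]
    refine (Finset.abs_sum_le_sum_abs _ _).trans (Finset.sum_le_sum fun k _ => ?_)
    rw [abs_mul]
    exact mul_le_mul_of_nonneg_left (norm_le_pi_norm (e n ω) k) (abs_nonneg _)
  have hsplit : |((n : ℝ) • (G n *ᵥ e n ω)) j| = √(n : ℝ) * (√(n : ℝ) * |(G n *ᵥ e n ω) j|) := by
    rw [Pi.smul_apply, smul_eq_mul, abs_mul, Nat.abs_cast, ← mul_assoc,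
      Real.mul_self_sqrt (Nat.cast_nonneg n)]
  rw [hsplit] at hω
  have hTle : T n ≤ √(n : ℝ) * |(G n *ᵥ e n ω) j| := le_of_mul_le_mul_left hω hn'
  rw [div_le_iff₀ hKpos, norm_smul, Real.norm_of_nonneg hm'.le]
  calc T n ≤ √(n : ℝ) * ((∑ k, |G n j k|) * ‖e n ω‖) :=
        hTle.trans (mul_le_mul_of_nonneg_left hmul hn'.le)
    _ = √(m n : ℝ) * ‖e n ω‖ * (√((n : ℝ) / m n) * ∑ k, |G n j k|) := by
        rw [Real.sqrt_div (Nat.cast_nonneg n)]; field_simp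
    _ ≤ √(m n : ℝ) * ‖e n ω‖ * K := mul_le_mul_of_nonneg_left hKn.le (by positivity)

/-- The normalized penalty gap `(eta - |lam|) / √n` diverges. -/
theorem tendsto_penalty_gap_atTop {lam eta : ℕ → ℝ} {ρ₀ : ℝ} (hρ₀ : 0 ≤ ρ₀) (hρ₁ : ρ₀ < 1)
    (heta : Tendsto (fun n : ℕ => eta n / √(n : ℝ)) atTop atTop)
    (hlam : Tendsto (fun n : ℕ => lam n / eta n) atTop (𝓝 ρ₀)) :
    Tendsto (fun n : ℕ => (eta n - |lam n|) / √(n : ℝ)) atTop atTop := by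
  have h1 : Tendsto (fun n => 1 - |lam n / eta n|) atTop (𝓝 (1 - ρ₀)) := by
    simpa only [abs_of_nonneg hρ₀] using hlam.abs.const_sub 1
  -- Factor the gap as `(eta / √n) * (1 - |lam / eta|)`.
  refine (heta.atTop_mul_pos (sub_pos.mpr hρ₁) h1).congr' ?_
  filter_upwards [heta.eventually_gt_atTop 0, eventually_gt_atTop 0] with n hn hn0
  have hs : (0 : ℝ) < √(n : ℝ) := Real.sqrt_pos.mpr (Nat.cast_pos.mpr hn0)
  have he : 0 < eta n := (div_pos_iff_of_pos_right hs).mp hn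
  rw [abs_div, abs_of_pos he]
  field_simp

theorem mainTheorem8 {Ω : Type*} [MeasurableSpace Ω] (P : Measure Ω) [IsProbabilityMeasure P]
    (p : ℕ) (βstar : Fin p → ℝ) (σ : ℝ≥0)
    -- design matrices: `C_n → C ≻ 0` and `(1/n) max_i ‖x_i‖₂² → 0`
    (X : ∀ n : ℕ, Matrix (Fin n) (Fin p) ℝ) (C : Matrix (Fin p) (Fin p) ℝ)
    (hC : C.PosDef)
    (hgram : Tendsto (fun n => gramMatrix (X n)) atTop (𝓝 C))
    (hrow : Tendsto (fun n => maxRowSqNorm (X n)) atTop (𝓝 0))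
    -- for each `n`, the noise has i.i.d. `N(0, σ²)` components
    (ε : ∀ n : ℕ, Ω → Fin n → ℝ)
    (hεlaw : ∀ (n : ℕ) (i : Fin n), HasLaw (fun ω => ε n ω i) (gaussianReal 0 (σ ^ 2)) P)
    (hεindep : ∀ n : ℕ, iIndepFun (fun (i : Fin n) ω => ε n ω i) P)
    -- source sample size: `n / m → r₀ ∈ [0, ∞)`
    (m : ℕ → ℕ) (hm : ∀ᶠ n in atTop, 0 < m n)
    (r₀ : ℝ) (hr₀ : 0 ≤ r₀)
    (hnm : Tendsto (fun n : ℕ => (n : ℝ) / (m n : ℝ)) atTop (𝓝 r₀))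
    -- initial estimator: independent of the target noise, and `√m (βinit - β*)` converges
    -- in distribution to a probability law `ν`
    (βinit : ℕ → Ω → Fin p → ℝ)
    (hindep : ∀ n : ℕ, IndepFun (βinit n) (ε n) P)
    (ν : Measure (Fin p → ℝ)) [IsProbabilityMeasure ν]
    (hinit : TendstoInDistribution
      (fun (n : ℕ) ω => √(m n : ℝ) • (βinit n ω - βstar)) atTop
      (id : (Fin p → ℝ) → Fin p → ℝ) (fun _ => P) ν)
    (hincons : InconsistentActiveSelection P βstar βinit)
    -- regime (i) of the tuning parameters
    (lam eta : ℕ → ℝ) (ρ₀ : ℝ) (hρ₀ : 0 ≤ ρ₀) (hρ₁ : ρ₀ < 1)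
    (heta : Tendsto (fun n : ℕ => eta n / √(n : ℝ)) atTop atTop)
    (hlam : Tendsto (fun n : ℕ => lam n / eta n) atTop (𝓝 ρ₀))
    -- the Transfer Lasso estimator
    (βhat : ℕ → Ω → Fin p → ℝ)
    (hβhat : ∀ n : ℕ, ∀ᵐ ω ∂P,
      IsTransferLasso (X n) (linearResponse (X n) βstar (ε n ω)) (βinit n ω)
        (lam n) (eta n) (βhat n ω)) :
    ConsistentInvariantSelection P βstar βinit βhat := by
  have hT := (tendsto_penalty_gap_atTop hρ₀ hρ₁ heta hlam).atTop_div_const (four_pos (α := ℝ))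
  -- The `4` splits the gap: the score has two terms and enters doubled, so each term may use a
  -- quarter.
  set T : ℕ → ℝ := fun n => (eta n - |lam n|) / √(n : ℝ) / 4 with hTdef
  set A : ℕ → Fin p → Set Ω := fun n j => {ω | √(n : ℝ) * T n ≤ |((X n)ᵀ *ᵥ ε n ω) j|}
  set B : ℕ → Fin p → Set Ω := fun n j =>
    {ω | √(n : ℝ) * T n ≤ |((n : ℝ) • (gramMatrix (X n) *ᵥ (βinit n ω - βstar))) j|}
  have hbad : Tendsto (fun n => ∑ j, (P (A n j) + P (B n j))) atTop (𝓝 0) := by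
    have h := tendsto_finsetSum Finset.univ fun (j : Fin p) _ =>
      (tendsto_measure_le_abs_noise_score hgram hεlaw hεindep hT j).add
        (tendsto_measure_le_abs_gram_mulVec hgram hm hnm hinit hT j)
    simp only [add_zero, Finset.sum_const_zero] at h
    exact h
  have hlower : Tendsto (fun n => 1 - ∑ j, (P (A n j) + P (B n j))) atTop (𝓝 1) := by
    simpa using ENNReal.Tendsto.sub tendsto_const_nhds hbad (Or.inl ENNReal.one_ne_top)
  refine tendsto_of_tendsto_of_tendsto_of_le_of_le' hlower tendsto_const_nhds ?_
    (Eventually.of_forall fun _ => prob_le_one)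
  filter_upwards [eventually_gt_atTop 0] with n hn
  have hs : (0 : ℝ) < √(n : ℝ) := Real.sqrt_pos.mpr (Nat.cast_pos.mpr hn)
  have hgap : √(n : ℝ) * T n = (eta n - |lam n|) / 4 := by
    simp only [hTdef]; field_simp
  set good : Set Ω := {ω | ∀ j ∈ activeSet βstar, βhat n ω j = βinit n ω j}
  -- Only almost everywhere, since `βhat` is a minimizer only almost surely.
  have hcover : (Set.univ : Set Ω) ≤ᵐ[P] (good ∪ ⋃ j, (A n j ∪ B n j) : Set Ω) := by
    filter_upwards [hβhat n] with ω hω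
    refine fun _ => show ω ∈ good ∪ ⋃ j, (A n j ∪ B n j) from ?_
    by_contra hnot
    have hnot' : ω ∉ good ∧ ∀ j, ω ∉ A n j ∧ ω ∉ B n j := by
      simpa [Set.mem_union, Set.mem_iUnion, not_or] using hnot
    refine hnot'.1 fun j _ => congrFun (hω.eq_init_of_score_lt hn fun k => ?_) j
    have hA : |_| < √(n : ℝ) * T n := not_le.mp (hnot'.2 k).1
    have hB : |_| < √(n : ℝ) * T n := not_le.mp (hnot'.2 k).2
    rw [hgap] at hA hB
    rw [score_linearResponse hn, Pi.sub_apply]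
    linarith [abs_sub (((X n)ᵀ *ᵥ ε n ω) k)
      (((n : ℝ) • (gramMatrix (X n) *ᵥ (βinit n ω - βstar))) k)]
  have hone : 1 ≤ P good + ∑ j, (P (A n j) + P (B n j)) := by
    calc (1 : ℝ≥0∞) = P Set.univ := measure_univ.symm
      _ ≤ P (good ∪ ⋃ j, (A n j ∪ B n j)) := measure_mono_ae hcover
      _ ≤ P good + P (⋃ j, (A n j ∪ B n j)) := measure_union_le _ _
      _ ≤ P good + ∑ j, (P (A n j) + P (B n j)) := by
        gcongr
        exact (measure_iUnion_fintype_le P _).trans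
          (Finset.sum_le_sum fun j _ => measure_union_le _ _)
  exact tsub_le_iff_right.mpr hone
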